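/- For $n\ge 0$ let $z(n)=z(n,n;2,2)$ be the Zarankiewicz number, i.e. the maximum number of edges in a subgraph of the complete bipartite graph $K_{n,n}$ that does not contain $K_{2,2}=C_4$ as a subgraph (so $z(0)=0$). Then for every prime power $k$, and for $k=1$, $$ z(k^2+k+1-h)=\begin{cases} k^3+2k^2+2k+1 & \text{for } h=0,\\ k^3+2k^2 & \text{for } h=1,\\ k^3+2k^2-2k & \text{for } h=2,\\ k^3+2k^2-4k+1 & \text{for } h=3. \end{cases} $$ -/

import Mathlib

/-- The Zarankiewicz number `z(n) = z(n, n; 2, 2)`: the maximum number of edges in a subgraph of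
`K_{n,n}` that does not contain `K_{2,2} = C₄` as a (not necessarily induced) subgraph. -/
noncomputable def z (n : ℕ) : ℕ :=
  SimpleGraph.zarankiewicz n n 2 2

/-! Lower bounds: take a plane of order `k` (a triangle when `k = 1`) and delete `h` vertices and
`h` sides of a triangle with as many mutual flags as possible, since a flag shared by two deleted
elements is lost only once.

Upper bounds: two points share at most one line, so counting pairs of points on lines bounds the
flags (`QuadFree.two_mul_sum_le`); this is sharp for `h = 0`. For `h > 0`, too many flags would
leave, after discarding suitable points, a set with average degree at least `k + 1`, and the pair
count on that set fails (`QuadFree.deficiency_bound`). Small `k` is treated apart; for `h = 3`, `k =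
3` the count is an equality and a second one is needed. -/

section

open Finset

/-! ### Incidence relations and `C₄`-free bipartite graphs -/

open scoped Classical in
/-- The number of incident pairs of a relation between finite types. -/
noncomputable def incidenceCount {P L : Type*} [Fintype P] [Fintype L] (I : P → L → Prop) : ℕ :=
  ∑ p, #{l | I p l}

/-- An incidence relation is quadrilateral-free if two distinct points are never incident with two
distinct lines. -/
def QuadFree {P L : Type*} (I : P → L → Prop) : Prop :=
  ∀ ⦃p q l m⦄, I p l → I q l → I p m → I q m → p = q ∨ l = m

/-- The bipartite graph of an incidence relation. -/
def incidenceGraph {P L : Type*} (I : P → L → Prop) : SimpleGraph (P ⊕ L) where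
  Adj
    | .inl p, .inr l => I p l
    | .inr l, .inl p => I p l
    | _, _ => False
  symm := ⟨by rintro (p | l) (q | m) h <;> exact h⟩
  loopless := ⟨by rintro (p | l) h <;> exact h⟩

theorem incidenceGraph_le {P L : Type*} (I : P → L → Prop) :
    incidenceGraph I ≤ completeBipartiteGraph P L := by
  rintro (p | l) (q | m) h
  · exact h.elim
  · simp
  · simp
  · exact h.elim

theorem incidenceGraph_free {P L : Type*} {I : P → L → Prop} (hI : QuadFree I) :
    (completeBipartiteGraph (Fin 2) (Fin 2)).Free (incidenceGraph I) := by
  rintro ⟨f⟩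
  have adj (i j : Fin 2) : (incidenceGraph I).Adj (f (.inl i)) (f (.inr j)) :=
    f.toHom.map_adj (by simp)
  have hl : f (.inl 0) ≠ f (.inl 1) := fun h => by simpa using f.injective h
  have hr : f (.inr 0) ≠ f (.inr 1) := fun h => by simpa using f.injective h
  have h00 := adj 0 0
  have h01 := adj 0 1
  have h10 := adj 1 0
  have h11 := adj 1 1
  generalize f (.inl 0) = a, f (.inl 1) = b, f (.inr 0) = c, f (.inr 1) = d at *
  rcases a with a | a <;> rcases b with b | b <;> rcases c with c | c <;> rcases d with d | d <;>
    first
    | exact h00.elim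
    | exact h01.elim
    | exact h10.elim
    | exact h11.elim
    | exact absurd (hI h00 h10 h01 h11) (by simp_all)
    | exact absurd (hI h00 h01 h10 h11) (by simp_all)

open scoped Classical in
theorem incidenceCount_eq_card {P L : Type*} [Fintype P] [Fintype L] (I : P → L → Prop) :
    incidenceCount I = #{x : P × L | I x.1 x.2} := by
  simp only [incidenceCount, card_filter, ← univ_product_univ, sum_product]

/-- A quadrilateral-free incidence relation on `n` points and `n` lines has at most `z n`
incidences. -/
theorem incidenceCount_le_z {P L : Type*} [Fintype P] [Fintype L] {I : P → L → Prop}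
    (hI : QuadFree I) {n : ℕ} (hP : Fintype.card P = n) (hL : Fintype.card L = n) :
    incidenceCount I ≤ z n := by
  classical
  have h := (SimpleGraph.zarankiewicz_le_iff hP hL (Fintype.card_fin 2) (Fintype.card_fin 2)
    (z n)).1 le_rfl (incidenceGraph_le I) (incidenceGraph_free hI)
  refine le_trans ?_ h
  rw [incidenceCount_eq_card]
  refine card_le_card_of_injOn (fun x => s(.inl x.1, .inr x.2)) ?_ ?_
  · intro x hx
    have : I x.1 x.2 := by simpa using hx
    rwa [mem_coe, SimpleGraph.mem_edgeFinset]
  · rintro ⟨p, l⟩ - ⟨q, m⟩ - h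
    simpa using h

/-- To bound `z n` it suffices to bound the incidences of quadrilateral-free relations on `n`
points and `n` lines. -/
theorem z_le_of_incidenceCount_le {n x : ℕ}
    (h : ∀ I : Fin n → Fin n → Prop, QuadFree I → incidenceCount I ≤ x) : z n ≤ x := by
  classical
  refine (SimpleGraph.zarankiewicz_le_iff (Fintype.card_fin n) (Fintype.card_fin n)
    (Fintype.card_fin 2) (Fintype.card_fin 2) x).2 fun G _ hG hfree => ?_
  have hI : QuadFree fun p l => G.Adj (.inl p) (.inr l) := by
    intro p q l m hpl hql hpm hqm
    by_contra! hne
    refine hfree ⟨⟨⟨Sum.map ![p, q] ![l, m], ?_⟩, ?_⟩⟩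
    · rintro (i | i) (j | j) hij
      · simp at hij
      · fin_cases i <;> fin_cases j <;> simpa
      · fin_cases i <;> fin_cases j <;> simpa [G.adj_comm]
      · simp at hij
    · refine Function.Injective.sumMap ?_ ?_
      · intro i j hij
        fin_cases i <;> fin_cases j <;> simp_all [eq_comm]
      · intro i j hij
        fin_cases i <;> fin_cases j <;> simp_all [eq_comm]
  refine le_trans ?_ (h _ hI)
  rw [incidenceCount_eq_card]
  refine le_trans (card_le_card ?_)
    (card_image_le (f := fun y : Fin n × Fin n => s(Sum.inl y.1, Sum.inr y.2)))
  intro y hy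
  induction y with | _ a b
  have hab : G.Adj a b := by simpa using hy
  have := hG hab
  rcases a with a | a <;> rcases b with b | b
  · simp at this
  · exact mem_image.2 ⟨(a, b), by simpa using hab, rfl⟩
  · exact mem_image.2 ⟨(b, a), by simpa using hab.symm, Sym2.eq_swap⟩
  · simp at this

/-! ### Pair counting -/

section Counting

open scoped Classical

variable {P L : Type*} [Fintype L] {I : P → L → Prop}

theorem sum_card_lines_eq_sum_card_points (I : P → L → Prop) (A : Finset P) :
    ∑ p ∈ A, #{l | I p l} = ∑ l, #{p ∈ A | I p l} := by
  simp only [card_filter]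
  exact sum_comm

/-- Two points lie on at most one common line, counted over the pairs in `A × B`. -/
theorem QuadFree.sum_mul_card_le (hI : QuadFree I) {A B : Finset P} (hAB : A ⊆ B) :
    ∑ l, #{p ∈ A | I p l} * #{p ∈ B | I p l} + #A ≤ #A * #B + ∑ p ∈ A, #{l | I p l} := by
  have hswap : ∑ l, #{p ∈ A | I p l} * #{p ∈ B | I p l} =
      ∑ p ∈ A, ∑ q ∈ B, #{l | I p l ∧ I q l} := by
    simp only [card_filter, sum_mul_sum, mul_ite, mul_one, mul_zero, ← ite_and]
    rw [sum_comm]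
    refine sum_congr rfl fun p _ => ?_
    rw [sum_comm]
    refine sum_congr rfl fun q _ => sum_congr rfl fun l _ => ?_
    simp only [and_comm]
  have hpoint (p) (hp : p ∈ A) : ∑ q ∈ B, #{l | I p l ∧ I q l} + 1 ≤ #B + #{l | I p l} := by
    rw [← add_sum_erase B _ (hAB hp)]
    have h1 : ∑ q ∈ B.erase p, #{l | I p l ∧ I q l} ≤ ∑ q ∈ B.erase p, 1 := by
      refine sum_le_sum fun q hq => card_le_one.2 fun l hl m hm => ?_
      simp only [mem_filter_univ] at hl hm
      exact (hI hl.1 hl.2 hm.1 hm.2).resolve_left (ne_of_mem_erase hq).symm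
    have h2 := card_erase_add_one (hAB hp)
    simp only [and_self, sum_const, smul_eq_mul, mul_one] at *
    omega
  have := sum_le_sum hpoint
  rw [sum_add_distrib, sum_add_distrib, ← hswap] at this
  simpa using this

/-- The pair count, linearised at the block sizes `m` and `m + 1`. -/
theorem QuadFree.two_mul_sum_le (hI : QuadFree I) (A : Finset P) (m : ℤ) :
    2 * m * ∑ p ∈ A, (#{l | I p l} : ℤ) ≤
      #A * (#A - 1) + Fintype.card L * (m * (m + 1)) := by
  have h1 : ((∑ l, #{p ∈ A | I p l} * #{p ∈ A | I p l} + #A : ℕ) : ℤ) ≤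
    (#A * #A + ∑ p ∈ A, #{l | I p l} : ℕ) := by exact_mod_cast hI.sum_mul_card_le subset_rfl
  have h2 : ((∑ p ∈ A, #{l | I p l} : ℕ) : ℤ) = (∑ l, #{p ∈ A | I p l} : ℕ) := by
    exact_mod_cast sum_card_lines_eq_sum_card_points I A
  have h3 : ∑ l : L, ((2 * m + 1) * (#{p ∈ A | I p l} : ℤ) - m * (m + 1)) ≤
      ∑ l, (#{p ∈ A | I p l} : ℤ) * #{p ∈ A | I p l} := by
    refine sum_le_sum fun l _ => ?_
    have : 0 ≤ ((#{p ∈ A | I p l} : ℤ) - m) * ((#{p ∈ A | I p l} : ℤ) - m - 1) := by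
      rcases le_or_gt (#{p ∈ A | I p l} : ℤ) m with h | h
      · exact mul_nonneg_of_nonpos_of_nonpos (by omega) (by omega)
      · exact mul_nonneg (by omega) (by omega)
    linarith
  rw [sum_sub_distrib, ← mul_sum] at h3
  push_cast at h1 h2
  simp only [sum_const, card_univ, nsmul_eq_mul] at h3
  rw [← h2] at h3
  linarith

/-- If values over `S` sum to at least `c * #S - d`, then some `#S - d` of them have average at
least `c`. -/
theorem exists_subset_mul_card_le_sum {α : Type*} (f : α → ℕ) (c d : ℕ) (S : Finset α)
    (hd : d ≤ #S) (h : c * #S ≤ ∑ a ∈ S, f a + d) :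
    ∃ A ⊆ S, #A + d = #S ∧ c * #A ≤ ∑ a ∈ A, f a := by
  induction d generalizing S with
  | zero => exact ⟨S, subset_rfl, rfl, h⟩
  | succ d ih =>
    -- Dropping a value below `c` lowers the deficit by at least one; once none is left, any subset
    -- of the right size works.
    by_cases hlow : ∃ a ∈ S, f a < c
    · obtain ⟨a, ha, hac⟩ := hlow
      have h1 := card_erase_add_one ha
      have h2 := add_sum_erase S f ha
      obtain ⟨A, hA, hcard, hsum⟩ := ih (S.erase a) (by omega) (by
        rw [← h1, mul_add] at h
        omega)
      exact ⟨A, hA.trans (erase_subset _ _), by omega, hsum⟩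
    · push Not at hlow
      obtain ⟨A, hA, hcard⟩ := exists_subset_card_eq (Nat.sub_le (#S) (d + 1))
      refine ⟨A, hA, by omega, ?_⟩
      rw [mul_comm, ← smul_eq_mul]
      exact card_nsmul_le_sum _ _ _ fun a ha => hlow a (hA ha)

variable [Fintype P]

theorem QuadFree.two_mul_incidenceCount_le (hI : QuadFree I) (m : ℤ) :
    2 * m * incidenceCount I ≤
      Fintype.card P * (Fintype.card P - 1) + Fintype.card L * (m * (m + 1)) := by
  simpa [incidenceCount] using hI.two_mul_sum_le univ m

theorem exists_card_of_le_incidenceCount {n c d : ℕ}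
    (hP : Fintype.card P = n) (hd : d ≤ n) (h : c * n ≤ incidenceCount I + d) :
    ∃ A : Finset P, (#A : ℤ) = n - d ∧ (c * #A : ℤ) ≤ ∑ p ∈ A, (#{l | I p l} : ℤ) := by
  subst hP
  obtain ⟨A, -, hA, hs⟩ :=
    exists_subset_mul_card_le_sum (fun p => #{l | I p l}) c d univ hd h
  refine ⟨A, ?_, by exact_mod_cast hs⟩
  rw [card_univ] at hA
  omega

/-- The incidence count forced by discarding the `d` points of lowest degree. -/
theorem QuadFree.deficiency_bound (hI : QuadFree I) {n c d : ℕ}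
    (hP : Fintype.card P = n) (hL : Fintype.card L = n) (hd : d ≤ n)
    (h : c * n ≤ incidenceCount I + d) {m : ℤ} (hm : 0 ≤ m) :
    2 * m * (c * (n - d)) ≤ ((n : ℤ) - d) * (n - d - 1) + n * (m * (m + 1)) := by
  obtain ⟨A, hA, hs⟩ := exists_card_of_le_incidenceCount hP hd h
  have := hI.two_mul_sum_le A m
  rw [hL] at this
  rw [hA] at this hs
  exact (mul_le_mul_of_nonneg_left hs (by positivity)).trans this

theorem incidenceCount_le_sq {n : ℕ} (hP : Fintype.card P = n) (hL : Fintype.card L = n)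
    (I : P → L → Prop) : incidenceCount I ≤ n * n := by
  rw [incidenceCount_eq_card]
  refine (card_le_univ _).trans ?_
  rw [Fintype.card_prod, hP, hL]

/-- With 35 flags, five points of average degree at least 4 attain equality in the pair count, so
every line meets them exactly twice. Pairing them with all ten points then gives `2 * incidenceCount
I ≤ 65`. -/
theorem QuadFree.incidenceCount_le_thirty_four (hI : QuadFree I)
    (hP : Fintype.card P = 10) (hL : Fintype.card L = 10) : incidenceCount I ≤ 34 := by
  by_contra! hlt
  obtain ⟨A, hA, hs⟩ := exists_card_of_le_incidenceCount (I := I) (c := 4) (d := 5) hP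
    (by norm_num) (by omega)
  have hA5 : #A = 5 := by
    push_cast at hA
    omega
  have hflag := sum_card_lines_eq_sum_card_points I A
  have hpairs := hI.sum_mul_card_le (subset_rfl : A ⊆ A)
  have hmixed := hI.sum_mul_card_le (subset_univ A)
  have hall : incidenceCount I = ∑ l, #{p | I p l} := sum_card_lines_eq_sum_card_points I univ
  set F := ∑ p ∈ A, #{l | I p l} with hF
  have hF20 : 20 ≤ F := by
    rw [hA5] at hs
    push_cast at hs
    zify [hF]
    linarith
  rw [hA5] at hpairs hmixed
  rw [card_univ, hP] at hmixed
  have hnonneg (l : L) : 0 ≤ ((#{p ∈ A | I p l} : ℤ) - 1) * ((#{p ∈ A | I p l} : ℤ) - 2) := by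
    rcases le_or_gt (#{p ∈ A | I p l} : ℤ) 1 with h | h
    · exact mul_nonneg_of_nonpos_of_nonpos (by omega) (by omega)
    · exact mul_nonneg (by omega) (by omega)
  have hexpand : ∑ l, ((#{p ∈ A | I p l} : ℤ) - 1) * ((#{p ∈ A | I p l} : ℤ) - 2) =
      ∑ l, (#{p ∈ A | I p l} : ℤ) * #{p ∈ A | I p l} - 3 * ∑ l, (#{p ∈ A | I p l} : ℤ) + 20 := by
    rw [mul_sum, ← sum_sub_distrib]
    have : (20 : ℤ) = ∑ l : L, 2 := by simp [hL]
    rw [this, ← sum_add_distrib]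
    exact sum_congr rfl fun l _ => by ring
  have hflag' : (F : ℤ) = ∑ l, (#{p ∈ A | I p l} : ℤ) := by exact_mod_cast hflag
  have hpairs' : ∑ l, (#{p ∈ A | I p l} : ℤ) * #{p ∈ A | I p l} + 5 ≤ 5 * 5 + F := by
    exact_mod_cast hpairs
  have hF20' : (20 : ℤ) ≤ F := by exact_mod_cast hF20
  have hzero : ∑ l, ((#{p ∈ A | I p l} : ℤ) - 1) * ((#{p ∈ A | I p l} : ℤ) - 2) = 0 :=
    le_antisymm (by linarith) (sum_nonneg fun l _ => hnonneg l)
  have hF_eq : (F : ℤ) = 20 := by linarith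
  have hle (l : L) : (#{p ∈ A | I p l} : ℤ) ≤ 2 := by
    have := (sum_eq_zero_iff_of_nonneg fun l _ => hnonneg l).1 hzero l (mem_univ l)
    rcases mul_eq_zero.1 this with h | h <;> omega
  have hsum2 : ∑ l, (2 - (#{p ∈ A | I p l} : ℤ)) = 0 := by
    rw [sum_sub_distrib, ← hflag', hF_eq]
    simp [hL]
  have htwo (l : L) : #{p ∈ A | I p l} = 2 := by
    have := (sum_eq_zero_iff_of_nonneg fun l _ => sub_nonneg.2 (hle l)).1 hsum2 l (mem_univ l)
    omega
  simp only [htwo, ← mul_sum] at hmixed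
  rw [← hall] at hmixed
  omega

end Counting

/-! ### Planes and triangle deletion -/

section Deletion

open scoped Classical

variable {P L : Type*} {I : P → L → Prop}

theorem QuadFree.comp (hI : QuadFree I) {P' L' : Type*} {f : P' → P} {g : L' → L}
    (hf : f.Injective) (hg : g.Injective) : QuadFree fun p l => I (f p) (g l) :=
  fun _ _ _ _ h1 h2 h3 h4 => (hI h1 h2 h3 h4).imp (@hf _ _) (@hg _ _)

variable [Fintype P] [Fintype L]

/-- Inclusion-exclusion for deleting points and lines from a regular configuration. -/
theorem incidenceCount_deletion {d : ℕ} (hp : ∀ p, #{l | I p l} = d) (hl : ∀ l, #{p | I p l} = d)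
    (S : Finset P) (T : Finset L) :
    incidenceCount (fun (p : {p // p ∉ S}) (l : {l // l ∉ T}) => I p l) + d * #S + d * #T =
      d * Fintype.card P + ∑ p ∈ S, #{l ∈ T | I p l} := by
  have hcount : incidenceCount (fun (p : {p // p ∉ S}) (l : {l // l ∉ T}) => I p l) =
      ∑ p ∈ Sᶜ, #{l ∈ Tᶜ | I p l} := by
    rw [incidenceCount, ← sum_subtype _ (by simp : ∀ p, p ∈ Sᶜ ↔ p ∉ S)
      (fun p => #{l : {l // l ∉ T} | I p l})]
    refine sum_congr rfl fun p _ => ?_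
    rw [card_filter, card_filter, ← sum_subtype _ (by simp : ∀ l, l ∈ Tᶜ ↔ l ∉ T)
      (fun l => if I p l then 1 else 0)]
  have hsplit (p : P) : #{l ∈ Tᶜ | I p l} + #{l ∈ T | I p l} = d := by
    rw [← hp p, ← card_union_of_disjoint, ← filter_union, union_comm, union_compl]
    exact disjoint_filter_filter disjoint_compl_left
  have hT : ∑ p, #{l ∈ T | I p l} = d * #T := by
    simp only [card_filter]
    rw [sum_comm]
    simp only [← card_filter, hl, sum_const, smul_eq_mul, mul_comm]
  have hS : ∑ p ∈ Sᶜ, (#{l ∈ Tᶜ | I p l} + #{l ∈ T | I p l}) = #Sᶜ * d := by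
    simp only [hsplit, sum_const, smul_eq_mul]
  rw [sum_add_distrib] at hS
  rw [hcount, ← card_add_card_compl S, mul_add, mul_comm d #Sᶜ, ← hS, ← hT,
    ← sum_add_sum_compl S]
  ring

end Deletion

open scoped Classical in
/-- For a prime power `k`, and for `k = 1`, there is a self-dual plane of order `k` with a triangle
whose vertices and sides correspond under the duality. -/
theorem exists_plane_with_triangle {k : ℕ} (hk : IsPrimePow k ∨ k = 1) :
    ∃ (P : Type) (_ : Fintype P) (I : P → P → Prop) (e : Fin 3 ↪ P),
      QuadFree I ∧ Fintype.card P = k ^ 2 + k + 1 ∧ (∀ p, #{l | I p l} = k + 1) ∧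
      (∀ l, #{p | I p l} = k + 1) ∧ ∀ i j, I (e i) (e j) ↔ i ≠ j := by
  rcases hk with hk | rfl
  · obtain ⟨p, r, hp, hr, rfl⟩ := (isPrimePow_nat_iff k).1 hk
    have : Fact p.Prime := ⟨hp⟩
    let K := GaloisField p r
    let P := Projectivization K (Fin 3 → K)
    let _ : Fintype P := Fintype.ofFinite P
    have hcard : Fintype.card P = (p ^ r) ^ 2 + p ^ r + 1 := by
      rw [← Nat.card_eq_fintype_card, Projectivization.card_of_finrank K _ (by simp : _ = 3),
        GaloisField.card p r hr.ne']
      simp only [sum_range_succ, sum_range_zero]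
      ring
    have horder : Configuration.ProjectivePlane.order P P = p ^ r := by
      have h := Configuration.ProjectivePlane.card_points P P
      rw [hcard] at h
      generalize Configuration.ProjectivePlane.order P P = a at h
      generalize p ^ r = b at h
      rcases lt_trichotomy a b with hlt | heq | hlt
      · nlinarith
      · exact heq
      · nlinarith
    have hne (i : Fin 3) : (Pi.single i 1 : Fin 3 → K) ≠ 0 := by simp
    -- The coordinate triangle is self-polar: each vertex lies on the polars of the other two but
    -- not on its own.
    have horth (i j : Fin 3) : (Projectivization.mk K _ (hne i)).orthogonal
        (Projectivization.mk K _ (hne j)) ↔ i ≠ j := by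
      rw [Projectivization.orthogonal_mk]
      simp [Pi.single_apply, eq_comm]
    refine ⟨P, inferInstance, Projectivization.orthogonal,
      ⟨fun i => Projectivization.mk K _ (hne i), ?_⟩, ?_, hcard, ?_, ?_, horth⟩
    · intro i j hij
      by_contra hij'
      exact (horth i i).1 (by simpa only [← hij] using (horth i j).2 hij') rfl
    · exact fun _ _ _ _ h1 h2 h3 h4 => Configuration.ofField.eq_or_eq_of_orthogonal h1 h2 h3 h4
    · intro q
      have := Configuration.ProjectivePlane.lineCount_eq P q
      rw [horder, Configuration.lineCount, Nat.card_eq_fintype_card, Fintype.card_subtype] at this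
      convert this
      rfl
    · intro q
      have := Configuration.ProjectivePlane.pointCount_eq P q
      rw [horder, Configuration.pointCount, Nat.card_eq_fintype_card, Fintype.card_subtype] at this
      convert this
      rfl
  · refine ⟨Fin 3, inferInstance, (· ≠ ·), .refl _, ?_, rfl, ?_, ?_, fun _ _ => Iff.rfl⟩
    · unfold QuadFree
      decide
    · intro p
      simp [filter_ne]
    · intro p
      simp [filter_ne']

/-- Deleting vertices and sides of a triangle from a plane of order `k`. -/
theorem le_z_of_triangle_deletion {k : ℕ} (hk : IsPrimePow k ∨ k = 1) {c : ℕ}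
    (s t : Finset (Fin 3)) (hs : #s = c) (ht : #t = c) {b : ℕ} (hb : ∑ i ∈ s, #{j ∈ t | i ≠ j} = b) :
    (k + 1) * (k ^ 2 + k + 1) + b ≤
      z (k ^ 2 + k + 1 - c) + 2 * c * (k + 1) := by
  classical
  obtain ⟨P, _, I, e, hI, hcard, hp, hl, he⟩ := exists_plane_with_triangle hk
  have h := incidenceCount_deletion (I := I) (d := k + 1) (by convert hp) (by convert hl)
    (s.map e) (t.map e)
  have hz := incidenceCount_le_z (n := k ^ 2 + k + 1 - c)
    (hI.comp (f := ((↑) : {p // p ∉ s.map e} → P)) (g := ((↑) : {l // l ∉ t.map e} → P))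
      Subtype.val_injective Subtype.val_injective)
    (by rw [Fintype.card_subtype_compl, hcard, Fintype.card_coe, card_map, hs])
    (by rw [Fintype.card_subtype_compl, hcard, Fintype.card_coe, card_map, ht])
  have hsum : ∑ p ∈ s.map e, #{l ∈ t.map e | I p l} = b := by
    rw [← hb]
    simp only [sum_map, filter_map, card_map, Function.comp_def, he]
  rw [hcard, card_map, card_map, hs, ht] at h
  rw [hsum] at h
  nlinarith

/-! ### Upper bounds for the four sizes -/

theorem z_plane_le {k : ℕ} (hk : 0 < k) :
    (z (k ^ 2 + k + 1) : ℤ) ≤ (k : ℤ) ^ 3 + 2 * (k : ℤ) ^ 2 + 2 * (k : ℤ) + 1 := by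
  have : z (k ^ 2 + k + 1) ≤ k ^ 3 + 2 * k ^ 2 + 2 * k + 1 := by
    refine z_le_of_incidenceCount_le fun I hI => ?_
    -- As `n - 1 = k(k + 1)`, the choice `m = k` gives exactly `(k + 1)n`.
    have h := hI.two_mul_incidenceCount_le k
    simp only [Fintype.card_fin] at h
    push_cast at h
    zify
    have hk' : (0 : ℤ) < k := by exact_mod_cast hk
    refine le_of_mul_le_mul_left ?_ (by positivity : (0 : ℤ) < 2 * k)
    linarith
  exact_mod_cast this

theorem z_plane_sub_one_le {k : ℕ} (hk : 0 < k) :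
    (z (k ^ 2 + k) : ℤ) ≤ (k : ℤ) ^ 3 + 2 * (k : ℤ) ^ 2 := by
  have : z (k ^ 2 + k) ≤ k ^ 3 + 2 * k ^ 2 := by
    refine z_le_of_incidenceCount_le fun I hI => ?_
    by_contra! hlt
    obtain ⟨j, rfl⟩ : ∃ j, k = j + 1 := ⟨k - 1, by omega⟩
    -- The deficit is `d = (k + 1)n - (k³ + 2k² + 1) = k - 1`; the mean block size `(k + 1)(n -
    -- d)/n` lies between `m = k` and `m + 1`.
    have h := hI.deficiency_bound (c := j + 2) (d := j) (m := j + 1) (Fintype.card_fin _)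
      (Fintype.card_fin _) (by nlinarith) (by nlinarith) (by positivity)
    push_cast at h
    nlinarith
  exact_mod_cast this

theorem z_plane_sub_two_le {k : ℕ} (hk : 0 < k) :
    (z (k ^ 2 + k - 1) : ℤ) ≤ (k : ℤ) ^ 3 + 2 * (k : ℤ) ^ 2 - 2 * (k : ℤ) := by
  obtain ⟨j, rfl⟩ : ∃ j, k = j + 1 := ⟨k - 1, by omega⟩
  have hn : (j + 1) ^ 2 + (j + 1) - 1 = j ^ 2 + 3 * j + 1 := by
    have : (j + 1) ^ 2 + (j + 1) = j ^ 2 + 3 * j + 2 := by ring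
    omega
  have : z ((j + 1) ^ 2 + (j + 1) - 1) ≤ j ^ 3 + 5 * j ^ 2 + 5 * j + 1 := by
    rw [hn]
    refine z_le_of_incidenceCount_le fun I hI => ?_
    -- At `k = 1` the choice `m = k - 1` is zero and the bound is void.
    rcases Nat.eq_zero_or_pos j with rfl | hj
    · exact incidenceCount_le_sq (Fintype.card_fin _) (Fintype.card_fin _) I
    by_contra! hlt
    -- Here `d = 2k - 2` and `m = k - 1`.
    have h := hI.deficiency_bound (c := j + 2) (d := 2 * j) (m := j) (Fintype.card_fin _)
      (Fintype.card_fin _) (by nlinarith) (by nlinarith) (by positivity)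
    push_cast at h
    nlinarith
  zify at this
  push_cast
  linarith

theorem z_plane_sub_three_le {k : ℕ} (hk : 0 < k) :
    (z (k ^ 2 + k - 2) : ℤ) ≤ (k : ℤ) ^ 3 + 2 * (k : ℤ) ^ 2 - 4 * (k : ℤ) + 1 := by
  obtain rfl | rfl | rfl | hk4 : k = 1 ∨ k = 2 ∨ k = 3 ∨ 4 ≤ k := by omega
  · have : z 0 ≤ 0 := z_le_of_incidenceCount_le fun I _ =>
      incidenceCount_le_sq (Fintype.card_fin _) (Fintype.card_fin _) I
    zify at this
    exact this
  · have : z 4 ≤ 9 := z_le_of_incidenceCount_le fun I hI => by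
      have h := hI.two_mul_incidenceCount_le 2
      simp only [Fintype.card_fin] at h
      omega
    zify at this
    exact this
  · have : z 10 ≤ 34 := z_le_of_incidenceCount_le fun I hI =>
      hI.incidenceCount_le_thirty_four (Fintype.card_fin _) (Fintype.card_fin _)
    zify at this
    exact this
  obtain ⟨j, rfl⟩ : ∃ j, k = j + 4 := ⟨k - 4, by omega⟩
  have hn : (j + 4) ^ 2 + (j + 4) - 2 = j ^ 2 + 9 * j + 18 := by
    have : (j + 4) ^ 2 + (j + 4) = j ^ 2 + 9 * j + 20 := by ring
    omega
  have : z ((j + 4) ^ 2 + (j + 4) - 2) ≤ j ^ 3 + 14 * j ^ 2 + 60 * j + 81 := by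
    rw [hn]
    refine z_le_of_incidenceCount_le fun I hI => ?_
    by_contra! hlt
    -- Here `d = 3k - 4` and `m = k - 2`; at `k = 3` both sides would agree, giving no
    -- contradiction.
    have h := hI.deficiency_bound (c := j + 5) (d := 3 * j + 8) (m := j + 2) (Fintype.card_fin _)
      (Fintype.card_fin _) (by nlinarith) (by nlinarith) (by positivity)
    push_cast at h
    nlinarith
  zify at this
  push_cast
  linarith

end

theorem theorem4 (k : ℕ) (hk : IsPrimePow k ∨ k = 1) :
    (z (k ^ 2 + k + 1) : ℤ) = (k : ℤ) ^ 3 + 2 * (k : ℤ) ^ 2 + 2 * (k : ℤ) + 1 ∧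
    (z (k ^ 2 + k + 1 - 1) : ℤ) = (k : ℤ) ^ 3 + 2 * (k : ℤ) ^ 2 ∧
    (z (k ^ 2 + k + 1 - 2) : ℤ) = (k : ℤ) ^ 3 + 2 * (k : ℤ) ^ 2 - 2 * (k : ℤ) ∧
    (z (k ^ 2 + k + 1 - 3) : ℤ) = (k : ℤ) ^ 3 + 2 * (k : ℤ) ^ 2 - 4 * (k : ℤ) + 1 := by
  have hpos : 0 < k := hk.elim IsPrimePow.pos fun h => h ▸ one_pos
  have h0 := le_z_of_triangle_deletion hk (c := 0) ∅ ∅ rfl rfl (b := 0) rfl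
  have h1 := le_z_of_triangle_deletion hk (c := 1) {0} {1} rfl rfl (b := 1) rfl
  -- Sharing just one index gives three flags; equal index sets would give only two.
  have h2 := le_z_of_triangle_deletion hk (c := 2) {0, 1} {0, 2} rfl rfl (b := 3) rfl
  have h3 := le_z_of_triangle_deletion hk (c := 3) Finset.univ Finset.univ rfl rfl (b := 6) rfl
  zify at h0 h1 h2 h3
  refine ⟨le_antisymm (z_plane_le hpos) ?_, le_antisymm (z_plane_sub_one_le hpos) ?_,
    le_antisymm (z_plane_sub_two_le hpos) ?_, le_antisymm (z_plane_sub_three_le hpos) ?_⟩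
  · rw [Nat.sub_zero] at h0
    linarith
  · linarith
  · linarith
  · linarith
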